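/- Let $R$ be a field, $f(x)\in R[x]$ an irreducible polynomial, $n\ge 1$ an integer and $A:=R[x]/(f(x)^n)$. For $1\le t\le n$ let $M(t)$ be the $A$-module $R[x]/(f(x)^t)$. Let $T=\{t_1,\dots,t_s\}$ with $t_1>t_2>\cdots>t_s$ be a non-empty subset of $\{1,\dots,n\}$, and put $M:=\bigoplus_{i=1}^s M(t_i)$ and $\Gamma:=\operatorname{End}_A(M)$. Put $B:=R[x]/(f(x)^{t_1})$; since $f(x)^{t_1}M=0$, $M$ is also a $B$-module. Then $$\operatorname{gldim}(\Gamma)=\begin{cases}0,&\text{if } t_1=1,\\ 2,&\text{if } t_1\neq 1 \text{ and } M \text{ is an additive generator for the category of finitely generated } B\text{-modules},\\ \infty,&\text{otherwise.}\end{cases}$$ In particular, $\operatorname{gldim}(\Gamma)<\infty$ if and only if $\Gamma$ is the Auslander algebra of $B$. Here $\operatorname{gldim}(\Gamma)$ is the supremum of the projective dimensions of the finitely generated left $\Gamma$-modules; a finitely generated $B$-module is an additive generator if every finitely generated $B$-module is a direct summand of a direct sum of finitely many copies of it; and "$\Gamma$ is the Auslander algebra of $B$" means that $B$ has only finitely many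 isomorphism classes of finitely generated indecomposable modules and that, for representatives $N_1,\dots,N_k$ of these classes, $\Gamma\cong\operatorname{End}_B(N_1\oplus\cdots\oplus N_k)$ as $R$-algebras. -/

import Mathlib

open CategoryTheory
open scoped Polynomial DirectSum

universe u

/-- The global dimension of `S`: the supremum of the projective dimensions of the finitely
generated left `S`-modules. (The zero module contributes `⊥`, so that only the zero ring has
global dimension `⊥`.) -/
noncomputable def globalDimension (S : Type u) [Ring S] : WithBot ℕ∞ :=
  ⨆ X : {X : ModuleCat.{u} S // Module.Finite S X}, projectiveDimension X.1

/-- `X` lies in `add(M)`: it is a direct summand of a direct sum of finitely many copies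
of `M`. -/
def IsInAdd (S : Type u) [Ring S] (M : Type u) [AddCommGroup M] [Module S M]
    (X : Type u) [AddCommGroup X] [Module S X] : Prop :=
  ∃ (k : ℕ) (i : X →ₗ[S] (Fin k → M)) (p : (Fin k → M) →ₗ[S] X), p ∘ₗ i = LinearMap.id

/-- `M` is an additive generator: it is a finitely generated `S`-module and every finitely
generated `S`-module lies in `add(M)`. -/
def IsAdditiveGenerator (S : Type u) [Ring S] (M : Type u) [AddCommGroup M] [Module S M] :
    Prop :=
  Module.Finite S M ∧
    ∀ (X : Type u) [AddCommGroup X] [Module S X] [Module.Finite S X], IsInAdd S M X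

open scoped ModuleCat in
/-- `G` is (isomorphic as an `R`-algebra to) the Auslander algebra of the `R`-algebra `S`:
`S` has, up to isomorphism, only finitely many finitely generated indecomposable modules, and
`G` is the endomorphism algebra of the direct sum of a complete list of them without
repetitions. -/
def IsAuslanderAlgebra (R : Type u) [Field R] (S : Type u) [Ring S] [Algebra R S]
    (G : Type u) [Ring G] [Algebra R G] : Prop :=
  ∃ (k : ℕ) (N : Fin k → ModuleCat.{u} S),
    (∀ i, Module.Finite S (N i) ∧ Indecomposable (N i)) ∧
    (∀ i j, Nonempty (N i ≅ N j) → i = j) ∧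
    (∀ X : ModuleCat.{u} S, Module.Finite S X → Indecomposable X →
      ∃ i, Nonempty (X ≅ N i)) ∧
    Nonempty (G ≃ₐ[R] Module.End S (⨁ i, N i))

/-- The quotient algebra `R[x]/(f(x)^m)`. -/
abbrev TruncPoly {R : Type u} [Field R] (f : R[X]) (m : ℕ) : Type u :=
  R[X] ⧸ Ideal.span {f ^ m}

/-- The module `M(t) = R[x]/(f(x)^t)` over `R[x]/(f(x)^m)`, where `t ≤ m`. -/
def CyclicMod {R : Type u} [Field R] (f : R[X]) {t m : ℕ} (_ : t ≤ m) : Type u :=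
  TruncPoly f t

section CyclicMod

variable {R : Type u} [Field R] (f : R[X]) {t m : ℕ} (h : t ≤ m)

noncomputable instance CyclicMod.instAddCommGroup : AddCommGroup (CyclicMod f h) :=
  inferInstanceAs (AddCommGroup (TruncPoly f t))

noncomputable instance CyclicMod.instModuleBase : Module R (CyclicMod f h) :=
  inferInstanceAs (Module R (TruncPoly f t))

/-- `R[x]/(f(x)^m)` acts on `R[x]/(f(x)^t)` through the canonical surjection
`R[x]/(f(x)^m) → R[x]/(f(x)^t)`. -/
noncomputable instance CyclicMod.instModule : Module (TruncPoly f m) (CyclicMod f h) :=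
  Module.compHom (TruncPoly f t)
    (Ideal.Quotient.factor (Ideal.span_singleton_le_span_singleton.2 (pow_dvd_pow f h)))

instance CyclicMod.instIsScalarTower : IsScalarTower R (TruncPoly f m) (CyclicMod f h) where
  smul_assoc r a x := by
    induction a using Submodule.Quotient.induction_on with | _ a
    induction x using Submodule.Quotient.induction_on with | _ x
    exact congrArg (Ideal.Quotient.mk (Ideal.span {f ^ t})) (smul_mul_assoc r a x)

end CyclicMod

/-- The module `⨁_{t ∈ T} M(t)` over `R[x]/(f(x)^m)`, where all elements of `T` are at
most `m`. -/
abbrev CyclicSum {R : Type u} [Field R] (f : R[X]) (T : Finset ℕ) {m : ℕ}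
    (h : ∀ t ∈ T, t ≤ m) : Type u :=
  ⨁ t : T, CyclicMod f (h t t.2)

/-! Everything depends on whether `T` has a gap, that is, whether `T` differs from `{1, …, t₁}`.

No gap: by the structure theorem over `R[x]`, every finitely generated `B`-module is a finite sum of
modules `M(t)`, so `M` is an additive generator. For an additive generator, Auslander's argument
bounds the global dimension by 2: a second syzygy over `Γ` has the form `Hom_B(Y, M)`, which is
projective because `Y` lies in `add(M)` (`globalDimension_moduleEnd_le_two`). If `t₁ ≥ 2`,
multiplication by `f` is a nonzero central nilpotent of `Γ`, and this excludes global dimension at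
most 1 (`two_le_globalDimension_of_isNilpotent`). If `t₁ = 1`, then `Γ` is semisimple.

Gap: choose `a ∈ T` and `b ∈ T ∪ {0}` with `b + 1 < a` and no element of `T` strictly between. Let
`ea`, `eb` be the idempotents of `Γ` projecting onto `M(a)`, `M(b)`, and consider `dim ea X - dim eb
X`. On the projective `Hom(M(t), M)` it equals `(min(t, a) - min(t, b)) * deg f`, which is `0` or
`(a - b) * deg f` since `t ≤ b` or `a ≤ t`. It is additive on short exact sequences, so `(a - b) *
deg f` divides it on every finitely generated module of finite projective dimension. The left ideal
generated by `f ^ (b + 1) • ea` has value `(a - b - 1) * deg f`, which is not divisible, so its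
projective dimension is infinite (`globalDimension_moduleEnd_eq_top_of_retracts`).

Hence finite global dimension forces `T = {1, …, t₁}`, and then `Γ` is the Auslander algebra of `B`.
Conversely, an Auslander algebra of `B` has global dimension at most 2 by the same bound. -/

/-! ### Global dimension: syzygies, ring isomorphisms, the semisimple case and a lower bound. -/

theorem globalDimension_le_iff (S : Type u) [Ring S] (n : ℕ) :
    globalDimension S ≤ n ↔ ∀ (X : Type u) [AddCommGroup X] [Module S X], Module.Finite S X →
      HasProjectiveDimensionLT (ModuleCat.of S X) (n + 1) := by
  simp only [globalDimension, iSup_le_iff, projectiveDimension_le_iff, Subtype.forall]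
  exact ⟨fun h X _ _ hX => h (ModuleCat.of S X) hX, fun h X hX => h X hX⟩

theorem hasProjectiveDimensionLT_ker_iff {S : Type u} [Ring S] {P X : Type u} [AddCommGroup P]
    [Module S P] [AddCommGroup X] [Module S X] [Module.Projective S P] (g : P →ₗ[S] X)
    (hg : Function.Surjective g) (n : ℕ) :
    HasProjectiveDimensionLT (ModuleCat.of S X) (n + 2) ↔
      HasProjectiveDimensionLT (ModuleCat.of S (LinearMap.ker g)) (n + 1) :=
  (LinearMap.shortExact_shortComplexKer hg).hasProjectiveDimensionLT_X₃_iff n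
    ((IsProjective.iff_projective P).1 inferInstance)

theorem projective_iff_hasProjectiveDimensionLT_one' {S : Type u} [Ring S] {X : Type u}
    [AddCommGroup X] [Module S X] :
    Module.Projective S X ↔ HasProjectiveDimensionLT (ModuleCat.of S X) 1 := by
  rw [← projective_iff_hasProjectiveDimensionLT_one, ← IsProjective.iff_projective]

theorem globalDimension_le_of_ringEquiv {S S' : Type u} [Ring S] [Ring S'] (e : S ≃+* S') :
    globalDimension S ≤ globalDimension S' := by
  refine iSup_le fun X => ?_
  let mod : Module S' X.1 := Module.compHom X.1 e.symm.toRingHom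
  have hsmul (s : S) (x : X.1) : e s • x = s • x :=
    congrArg (· • x) (e.symm_apply_apply s)
  let := RingHomInvPair.of_ringEquiv e
  let := RingHomInvPair.of_ringEquiv e.symm
  let Y : ModuleCat.{u} S' := ModuleCat.of S' X.1
  let e' : X.1 ≃ₛₗ[RingHomClass.toRingHom e] Y :=
    { AddEquiv.refl X.1 with
      map_smul' := fun s x => (hsmul s x).symm }
  have : Module.Finite S' Y := by
    have := X.2
    exact Module.Finite.of_surjective e'.toLinearMap e'.surjective
  rw [ModuleCat.projectiveDimension_eq_of_semiLinearEquiv e e']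
  exact le_iSup (fun X : {X : ModuleCat.{u} S' // Module.Finite S' X} =>
    projectiveDimension X.1) ⟨Y, this⟩

theorem globalDimension_eq_of_ringEquiv {S S' : Type u} [Ring S] [Ring S'] (e : S ≃+* S') :
    globalDimension S = globalDimension S' :=
  le_antisymm (globalDimension_le_of_ringEquiv e) (globalDimension_le_of_ringEquiv e.symm)

theorem globalDimension_eq_zero_of_isSemisimpleRing (S : Type u) [Ring S] [Nontrivial S]
    [IsSemisimpleRing S] : globalDimension S = 0 := by
  refine le_antisymm ((globalDimension_le_iff S 0).2 fun X _ _ _ => ?_) ?_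
  · exact projective_iff_hasProjectiveDimensionLT_one'.1 (Module.projective_of_isSemisimpleRing S X)
  · have : projectiveDimension (ModuleCat.of S S) = 0 :=
      have : Projective (ModuleCat.of S S) := (IsProjective.iff_projective S).1 inferInstance
      ModuleCat.projectiveDimension_eq_zero_of_projective _
    rw [← this]
    exact le_iSup (fun X : {X : ModuleCat.{u} S // Module.Finite S X} =>
      projectiveDimension X.1) ⟨ModuleCat.of S S, inferInstanceAs (Module.Finite S S)⟩

/-- If the global dimension were at most 1, the left ideal `Sz` would be projective and `S → Sz`, `s
↦ sz`, would split. The splitting sends `z` to some `w` with `zw = z`, which lets powers of `z` be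
cancelled until `z = 0`. -/
theorem two_le_globalDimension_of_isNilpotent {S : Type u} [Ring S] (z : S)
    (hz : ∀ s, Commute s z) (hnil : IsNilpotent z) (h0 : z ≠ 0) :
    2 ≤ globalDimension S := by
  by_contra hlt
  have hle : globalDimension S ≤ (1 : ℕ) := by
    rw [not_le] at hlt
    exact ENat.WithBot.lt_add_one_iff.1 (by simpa [one_add_one_eq_two] using hlt)
  have hcyc := (globalDimension_le_iff S 1).1 hle (S ⧸ Submodule.span S {z}) inferInstance
  have hker := (hasProjectiveDimensionLT_ker_iff (Submodule.span S {z}).mkQ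
    (Submodule.mkQ_surjective _) 0).1 hcyc
  rw [Submodule.ker_mkQ] at hker
  have hproj : Module.Projective S (Submodule.span S {z}) :=
    projective_iff_hasProjectiveDimensionLT_one'.2 hker
  let g : S →ₗ[S] Submodule.span S {z} :=
    (LinearMap.toSpanSingleton S S z).codRestrict _ fun s =>
      Submodule.smul_mem _ s (Submodule.mem_span_singleton_self z)
  have hg : Function.Surjective g := by
    rintro ⟨x, hx⟩
    obtain ⟨s, rfl⟩ := Submodule.mem_span_singleton.1 hx
    exact ⟨s, rfl⟩
  obtain ⟨σ, hσ⟩ := Module.projective_lifting_property g LinearMap.id hg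
  let ζ : Submodule.span S {z} := ⟨z, Submodule.mem_span_singleton_self z⟩
  have hw : z * σ ζ = z := by
    have := congrArg Subtype.val (LinearMap.congr_fun hσ ζ)
    rw [← (hz (σ ζ)).eq]
    exact this
  have key (k : ℕ) (hk : z ^ (k + 1) * z = 0) : z ^ k * z = 0 := by
    have h1 : z ^ (k + 1) • ζ = 0 := Subtype.ext hk
    have h2 : σ (z ^ (k + 1) • ζ) = z ^ k * z := by
      rw [map_smul, smul_eq_mul, pow_succ, mul_assoc, hw]
    rw [← h2, h1, map_zero]
  obtain ⟨n, hn⟩ := hnil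
  have hn' : z ^ n * z = 0 := by rw [hn, zero_mul]
  have : ∀ n, z ^ n * z = 0 → z = 0 := fun n => by
    induction n with
    | zero => simp
    | succ n ih => exact fun h => ih (key n h)
  exact h0 (this n hn')

/-! ### Auslander's bound for endomorphism rings of additive generators. -/

section AuslanderBound

variable {B : Type u} [CommRing B] {N : Type u} [AddCommGroup N] [Module B N]

/-- `Hom(-, N)` sends `N^k` to a free module and preserves retracts. -/
theorem projective_linearMap_of_isInAdd {Y : Type u} [AddCommGroup Y] [Module B Y]
    (hY : IsInAdd B N Y) : Module.Projective (Module.End B N) (Y →ₗ[B] N) := by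
  obtain ⟨k, i, p, hpi⟩ := hY
  let precomp {U V : Type u} [AddCommGroup U] [Module B U] [AddCommGroup V] [Module B V]
      (g : U →ₗ[B] V) : (V →ₗ[B] N) →ₗ[Module.End B N] (U →ₗ[B] N) :=
    { toFun := fun h => h ∘ₗ g
      map_add' := fun _ _ => rfl
      map_smul' := fun _ _ => rfl }
  have : Module.Projective (Module.End B N) ((Fin k → N) →ₗ[B] N) :=
    Module.Projective.of_equiv (LinearMap.lsum B (fun _ : Fin k => N) (Module.End B N))
  refine Module.Projective.of_split (precomp p) (precomp i) ?_
  ext h y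
  exact congrArg h (LinearMap.congr_fun hpi y)

theorem globalDimension_moduleEnd_le_two [IsNoetherianRing B] (hN : IsAdditiveGenerator B N) :
    globalDimension (Module.End B N) ≤ 2 := by
  have := hN.1
  have : IsNoetherianRing (Module.End B N) :=
    isNoetherian_of_tower B (inferInstanceAs (IsNoetherian B (N →ₗ[B] N)))
  refine (globalDimension_le_iff _ 2).2 fun X _ _ hX => ?_
  obtain ⟨b, p, hp⟩ := Module.Finite.exists_fin' (Module.End B N) X
  obtain ⟨a, q, hq⟩ := Module.Finite.exists_fin' (Module.End B N) (LinearMap.ker p)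
  refine (hasProjectiveDimensionLT_ker_iff p hp 1).2
    ((hasProjectiveDimensionLT_ker_iff q hq 0).2 (projective_iff_hasProjectiveDimensionLT_one'.1 ?_))
  -- The presentation map `q` is right multiplication by the matrix `G`. Under `Γ^a ≅ Hom(N^a, N)`
  -- it becomes precomposition with `φ : N^b → N^a`, so `ker q ≅ Hom(coker φ, N)`.
  let G (i : Fin a) (j : Fin b) : Module.End B N := (q (Pi.single i 1) : Fin b → Module.End B N) j
  have hqG (γ : Fin a → Module.End B N) (j : Fin b) :
      (q γ : Fin b → Module.End B N) j = ∑ i, γ i * G i j := by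
    conv_lhs => rw [pi_eq_sum_univ' γ]
    simp [G, Finset.sum_apply]
  let φ : (Fin b → N) →ₗ[B] (Fin a → N) :=
    LinearMap.pi fun i => ∑ j, G i j ∘ₗ LinearMap.proj j
  let Y := (Fin a → N) ⧸ LinearMap.range φ
  have hproj := projective_linearMap_of_isInAdd (hN.2 Y)
  let S : (Fin a → Module.End B N) ≃ₗ[Module.End B N] ((Fin a → N) →ₗ[B] N) :=
    LinearMap.lsum B (fun _ : Fin a => N) (Module.End B N)
  have hSφ (γ : Fin a → Module.End B N) (w : Fin b → N) :
      S γ (φ w) = ∑ j, (q γ : Fin b → Module.End B N) j (w j) := by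
    simp only [hqG]
    simp [S, φ, LinearMap.sum_apply]
    exact Finset.sum_comm
  have hS (γ : Fin a → Module.End B N) : q γ = 0 ↔ S γ ∘ₗ φ = 0 := by
    constructor
    · intro h
      ext1 j
      ext x
      simp [hSφ, h]
    · intro h
      ext j x
      have := hSφ γ (Pi.single j x)
      rw [← LinearMap.comp_apply, h, Finset.sum_eq_single j] at this
      · simpa using this.symm
      · intro j' _ hj'
        simp [Pi.single_eq_of_ne hj']
      · simp
  let F : LinearMap.ker q →ₗ[Module.End B N] (Y →ₗ[B] N) :=
    { toFun := fun γ => (LinearMap.range φ).liftQ (S γ.1)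
        (LinearMap.range_le_ker_iff.2 ((hS γ.1).1 γ.2))
      map_add' := fun _ _ => by ext; simp
      map_smul' := fun _ _ => by ext; simp }
  refine Module.Projective.of_equiv (LinearEquiv.ofBijective F ⟨?_, fun h => ?_⟩).symm
  · intro γ γ' h
    apply Subtype.ext
    apply S.injective
    exact congrArg (fun g => g ∘ₗ (LinearMap.range φ).mkQ) h
  · refine ⟨⟨S.symm (h ∘ₗ (LinearMap.range φ).mkQ), (hS _).2 ?_⟩, ?_⟩
    · ext1 j
      ext x
      have : φ.range.mkQ (φ (Pi.single j x)) = 0 :=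
        (Submodule.Quotient.mk_eq_zero _).2 (LinearMap.mem_range_self _ _)
      simp [this]
    · ext1
      ext1 x
      simp [F]

end AuslanderBound

/-! ### Dimension counts for modules over an `R`-algebra. -/

section RankOfAction

variable (R : Type u) [Field R] {G : Type u} [Ring G] [Algebra R G]

/-- The dimension over `R` of `s • X`, for an element `s` of an `R`-algebra acting on `X`. -/
noncomputable def smulRank (s : G) (X : Type u) [AddCommGroup X] [Module R X] [Module G X]
    [IsScalarTower R G X] : ℕ :=
  Module.finrank R (LinearMap.range (Algebra.lsmul R R X s))

theorem finrank_map_add_finrank_inf_ker {R : Type*} [Field R] {X Y : Type*} [AddCommGroup X]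
    [Module R X] [AddCommGroup Y] [Module R Y] [Module.Finite R X] (U : Submodule R X)
    (s : X →ₗ[R] Y) :
    Module.finrank R U = Module.finrank R (U.map s) +
      Module.finrank R (U ⊓ LinearMap.ker s : Submodule R X) := by
  rw [← LinearMap.finrank_range_add_finrank_ker (s.domRestrict U), LinearMap.range_domRestrict,
    LinearMap.ker_domRestrict, ← Submodule.finrank_map_subtype_eq U (Submodule.comap _ _),
    Submodule.map_comap_subtype]

variable {X Y : Type u} [AddCommGroup X] [Module R X] [Module G X]
    [IsScalarTower R G X] [AddCommGroup Y] [Module R Y] [Module G Y]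
    [IsScalarTower R G Y]

theorem smulRank_eq_add_ker [Module.Finite R X] {e : G} (he : e * e = e) (p : X →ₗ[G] Y)
    (hp : Function.Surjective p) :
    smulRank R e X = smulRank R e Y + smulRank R e (LinearMap.ker p) := by
  have himage : (LinearMap.range (Algebra.lsmul R R X e)).map (p.restrictScalars R) =
      LinearMap.range (Algebra.lsmul R R Y e) := by
    ext y
    simp only [Submodule.mem_map, LinearMap.mem_range, exists_exists_eq_and]
    constructor
    · rintro ⟨x, rfl⟩
      exact ⟨p x, by simp⟩
    · rintro ⟨y, rfl⟩
      obtain ⟨x, rfl⟩ := hp y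
      exact ⟨x, by simp⟩
  let incl : LinearMap.ker p →ₗ[R] X := (LinearMap.ker p).subtype.restrictScalars R
  have hker : (LinearMap.range (Algebra.lsmul R R X e)) ⊓ LinearMap.ker (p.restrictScalars R) =
      (LinearMap.range (Algebra.lsmul R R (LinearMap.ker p) e)).map incl := by
    ext x
    simp only [Submodule.mem_inf, Submodule.mem_map, LinearMap.mem_range, exists_exists_eq_and,
      LinearMap.mem_ker]
    constructor
    · rintro ⟨⟨y, rfl⟩, h⟩
      refine ⟨⟨e • y, h⟩, ?_⟩
      -- Idempotency of `e` makes `X ↦ eX` exact: an element of `eX` lying in `ker p` is fixed by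
      -- `e`, hence lies in `e • ker p`.
      change e • e • y = e • y
      rw [smul_smul, he]
    · rintro ⟨⟨y, hy⟩, rfl⟩
      refine ⟨⟨y, rfl⟩, ?_⟩
      change p (e • y) = 0
      rw [map_smul, LinearMap.mem_ker.1 hy, smul_zero]
  rw [smulRank, finrank_map_add_finrank_inf_ker _ (p.restrictScalars R), himage, hker,
    ← (Submodule.equivMapOfInjective incl Subtype.val_injective _).finrank_eq]
  rfl

end RankOfAction

/-- Every element of `X` annihilated by `s` is mapped by `t` into `v • X`. -/
def SMulKerLE {G : Type u} [Ring G] (s t v : G) (X : Type u) [AddCommGroup X] [Module G X] : Prop :=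
  ∀ x : X, s • x = 0 → ∃ y : X, t • x = v • y

/-- The condition can be checked coordinatewise on `G^k` and passes to retracts. Conditions verified
in `G` itself thus become available in every finitely generated projective module. -/
theorem SMulKerLE.of_projective {G : Type u} [Ring G] {s t v : G} (h : SMulKerLE s t v G)
    (X : Type u) [AddCommGroup X] [Module G X] [Module.Finite G X] [Module.Projective G X] :
    SMulKerLE s t v X := by
  intro x hx
  obtain ⟨k, p, hp⟩ := Module.Finite.exists_fin' G X
  obtain ⟨i, hi⟩ := Module.projective_lifting_property p LinearMap.id hp
  have hix : s • i x = 0 := by rw [← map_smul, hx, map_zero]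
  choose y hy using fun j => h (i x j) (congrFun hix j)
  refine ⟨p y, ?_⟩
  have : t • i x = v • y := funext hy
  rw [← map_smul, ← this, map_smul, ← LinearMap.comp_apply, hi, LinearMap.id_apply]

/-- `W` is a vector space over the field `R[x]/(f)`, which has degree `deg f` over `R`. -/
theorem natDegree_dvd_finrank_of_smul_eq_zero {R : Type u} [Field R] {f : R[X]}
    (hf : Irreducible f) {W : Type u} [AddCommGroup W] [Module R W] [Module R[X] W]
    [IsScalarTower R R[X] W] (h : ∀ w : W, f • w = 0) :
    f.natDegree ∣ Module.finrank R W := by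
  have htor : Module.IsTorsionBySet R[X] W (Ideal.span {f} : Ideal R[X]) :=
    (Module.isTorsionBySet_span_singleton_iff f).2 h
  let _ := htor.module
  have : IsScalarTower R (R[X] ⧸ Ideal.span {f}) W := htor.isScalarTower
  have hmax : (Ideal.span {f}).IsMaximal :=
    PrincipalIdealRing.isMaximal_of_irreducible hf
  let _ : Field (R[X] ⧸ Ideal.span {f}) := Ideal.Quotient.field _
  rw [← finrank_quotient_span_eq_natDegree,
    ← Module.finrank_mul_finrank R (R[X] ⧸ Ideal.span {f}) W]
  exact dvd_mul_right _ _

/-! ### A divisibility obstruction to finite projective dimension. -/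

section Gap

variable {R : Type u} [Field R] {f : R[X]} {G : Type u} [Ring G] [Algebra R G]
  [Algebra R[X] G] [IsScalarTower R R[X] G]

omit [IsScalarTower R R[X] G] in
-- By `h₁` and `h₂`, `j` identifies `eb X` with the kernel of `f ^ b` on `ea X`, so the difference
-- is the dimension of `f ^ b • ea X`. By `h₃` that space behaves like a free module over
-- `R[x]/(f^(a-b))`: each multiplication by `f` lowers the dimension by the same amount, a multiple
-- of `deg f`.
theorem dvd_smulRank_sub_of_projective (hf : Irreducible f) {a b : ℕ} (hab : b < a) {ea eb j : G}
    (hj : ea * j = j) (hj' : j * eb = j) (hfj : f ^ b • j = 0) (hfa : f ^ a • ea = 0)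
    (h₁ : SMulKerLE j eb 0 G) (h₂ : SMulKerLE (f ^ b • ea) ea j G)
    (h₃ : SMulKerLE (f ^ (a - 1) • ea) (f ^ b • ea) (f ^ (b + 1) • ea) G)
    (X : Type u) [AddCommGroup X] [Module R X] [Module R[X] X] [Module G X]
    [IsScalarTower R R[X] X] [IsScalarTower R[X] G X] [IsScalarTower R G X] [Module.Finite R X]
    [Module.Finite G X] [Module.Projective G X] :
    (((a - b) * f.natDegree : ℕ) : ℤ) ∣ smulRank R ea X - smulRank R eb X := by
  replace h₁ := h₁.of_projective X
  replace h₂ := h₂.of_projective X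
  replace h₃ := h₃.of_projective X
  let ρ (i : ℕ) : ℕ := smulRank R (f ^ i • ea) X
  have hmap (i k : ℕ) : (LinearMap.range (Algebra.lsmul R R X (f ^ i • ea))).map
      (Algebra.lsmul R R X (algebraMap R[X] G (f ^ k))) =
      LinearMap.range (Algebra.lsmul R R X (f ^ (i + k) • ea)) := by
    rw [← LinearMap.range_comp]
    congr 1
    ext x
    change algebraMap R[X] G (f ^ k) • (f ^ i • ea) • x = (f ^ (i + k) • ea) • x
    rw [algebraMap_smul, ← smul_assoc, smul_smul, pow_add, mul_comm]
  have hb : smulRank R ea X = ρ b + smulRank R eb X := by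
    have h0 : smulRank R ea X = ρ 0 := by simp [ρ]
    rw [h0]
    have hinf : LinearMap.range (Algebra.lsmul R R X eb) ⊓ LinearMap.ker (Algebra.lsmul R R X j) =
        ⊥ := by
      rw [eq_bot_iff]
      rintro _ ⟨⟨x, rfl⟩, hx⟩
      obtain ⟨y, hy⟩ := h₁ x (by
        rw [← hj', mul_smul]
        exact hx)
      rw [zero_smul] at hy
      exact hy
    have himage : (LinearMap.range (Algebra.lsmul R R X eb)).map (Algebra.lsmul R R X j) =
        LinearMap.range (Algebra.lsmul R R X (f ^ 0 • ea)) ⊓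
          LinearMap.ker (Algebra.lsmul R R X (algebraMap R[X] G (f ^ b))) := by
      apply le_antisymm
      · rintro _ ⟨_, ⟨x, rfl⟩, rfl⟩
        refine ⟨⟨j • x, ?_⟩, ?_⟩
        · change (f ^ 0 • ea) • j • x = j • eb • x
          rw [pow_zero, one_smul, smul_smul, smul_smul, hj, hj']
        · change algebraMap R[X] G (f ^ b) • j • eb • x = 0
          rw [algebraMap_smul, ← smul_assoc, hfj, zero_smul]
      · rintro _ ⟨⟨x, rfl⟩, hx⟩
        obtain ⟨y, hy⟩ := h₂ x (by
          rw [smul_assoc, ← algebraMap_smul G (f ^ b)]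
          rw [pow_zero, one_smul] at hx
          exact hx)
        refine ⟨eb • y, ⟨y, rfl⟩, ?_⟩
        change j • eb • y = (f ^ 0 • ea) • x
        rw [pow_zero, one_smul, hy, smul_smul, hj']
    simp only [ρ, smulRank]
    rw [finrank_map_add_finrank_inf_ker _ (Algebra.lsmul R R X (algebraMap R[X] G (f ^ b))),
      hmap, zero_add, ← himage,
      finrank_map_add_finrank_inf_ker (LinearMap.range (Algebra.lsmul R R X eb))
      (Algebra.lsmul R R X j), hinf, finrank_bot, add_zero]
  have hend : ρ a = 0 := by
    simp [ρ, smulRank, hfa]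
  -- Since `k ≤ a - 1 - b`, an element `f ^ b • ea • x` killed by `f ^ k` satisfies the premise of
  -- `h₃`, so it is already divisible by one more power of `f`.
  have hinf (k : ℕ) (hk : k < a - b) : LinearMap.range (Algebra.lsmul R R X (f ^ b • ea)) ⊓
        LinearMap.ker (Algebra.lsmul R R X (algebraMap R[X] G (f ^ k))) =
      LinearMap.range (Algebra.lsmul R R X (f ^ (b + 1) • ea)) ⊓
        LinearMap.ker (Algebra.lsmul R R X (algebraMap R[X] G (f ^ k))) := by
    apply le_antisymm
    · rintro _ ⟨⟨x, rfl⟩, hx⟩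
      refine ⟨?_, hx⟩
      obtain ⟨y, hy⟩ := h₃ x (by
        replace hx : algebraMap R[X] G (f ^ k) • (f ^ b • ea) • x = 0 := hx
        rw [algebraMap_smul] at hx
        rw [show a - 1 = (a - 1 - b - k) + (k + b) by omega, pow_add _ _ (k + b), mul_smul,
          pow_add, mul_smul, smul_assoc, smul_assoc, hx, smul_zero])
      exact ⟨y, hy.symm⟩
    · rintro _ ⟨⟨x, rfl⟩, hx⟩
      refine ⟨⟨algebraMap R[X] G f • x, ?_⟩, hx⟩
      change (f ^ b • ea) • algebraMap R[X] G f • x = (f ^ (b + 1) • ea) • x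
      rw [smul_smul, ← Algebra.commutes, ← Algebra.smul_def, smul_smul, ← pow_succ']
  -- By `hinf`, `f ^ k` has the same kernel on `f ^ b • ea X` and `f ^ (b + 1) • ea X`, so `ρ (b +
  -- k) - ρ (b + k + 1)` does not depend on `k`. At `k = a - b - 1` it equals `ρ (a - 1)`, because
  -- `ρ a = 0`.
  have hstep (k : ℕ) (hk : k < a - b) : ρ (b + k) = ρ (b + k + 1) + ρ (a - 1) := by
    have hsplit (i k : ℕ) : Module.finrank R (LinearMap.range (Algebra.lsmul R R X (f ^ i • ea))) =
        Module.finrank R (LinearMap.range (Algebra.lsmul R R X (f ^ (i + k) • ea))) +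
        Module.finrank R (LinearMap.range (Algebra.lsmul R R X (f ^ i • ea)) ⊓
          LinearMap.ker (Algebra.lsmul R R X (algebraMap R[X] G (f ^ k))) : Submodule R X) := by
      rw [← hmap, ← finrank_map_add_finrank_inf_ker]
    have e₁ := hsplit b k
    have e₂ := hsplit (b + 1) k
    have e₃ := hsplit b (a - b - 1)
    have e₄ := hsplit (b + 1) (a - b - 1)
    rw [hinf _ (by omega)] at e₁ e₃
    rw [show b + (a - b - 1) = a - 1 by omega] at e₃
    rw [show b + 1 + (a - b - 1) = a by omega] at e₄
    rw [show b + 1 + k = b + k + 1 by omega] at e₂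
    change Module.finrank R (LinearMap.range (Algebra.lsmul R R X (f ^ a • ea))) = 0 at hend
    change Module.finrank R (LinearMap.range (Algebra.lsmul R R X (f ^ (b + k) • ea))) =
      Module.finrank R (LinearMap.range (Algebra.lsmul R R X (f ^ (b + k + 1) • ea))) +
      Module.finrank R (LinearMap.range (Algebra.lsmul R R X (f ^ (a - 1) • ea)))
    omega
  have hρ (k : ℕ) (hk : k ≤ a - b) : ρ (a - k) = k * ρ (a - 1) := by
    induction k with
    | zero => simp [hend]
    | succ k ih =>
      have := hstep (a - b - (k + 1)) (by omega)
      rw [show b + (a - b - (k + 1)) + 1 = a - k by omega,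
        show b + (a - b - (k + 1)) = a - (k + 1) by omega, ih (by omega)] at this
      rw [this]; ring
  have hdeg : f.natDegree ∣ ρ (a - 1) := by
    have := natDegree_dvd_finrank_of_smul_eq_zero (R := R) hf
      (W := LinearMap.range (Algebra.lsmul R[X] R[X] X (f ^ (a - 1) • ea))) (by
        rintro ⟨_, x, rfl⟩
        ext1
        change f • (f ^ (a - 1) • ea) • x = 0
        rw [← smul_assoc, smul_smul, ← pow_succ', Nat.sub_add_cancel (by omega), hfa, zero_smul])
    exact this
  obtain ⟨c, hc⟩ := hdeg
  have := hρ (a - b) le_rfl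
  rw [show a - (a - b) = b by omega, hc] at this
  refine ⟨c, ?_⟩
  rw [hb, this]
  push_cast
  ring

/-- Induction along syzygies: the difference of ranks is additive on `0 → ker p → G^k → X → 0`, and
divisibility holds for the free module and, inductively, for the kernel. -/
theorem dvd_smulRank_sub_of_hasProjectiveDimensionLT (hf : Irreducible f) {a b : ℕ} (hab : b < a)
    {ea eb j : G} (hea : ea * ea = ea) (heb : eb * eb = eb)
    (hj : ea * j = j) (hj' : j * eb = j) (hfj : f ^ b • j = 0) (hfa : f ^ a • ea = 0)
    (h₁ : SMulKerLE j eb 0 G) (h₂ : SMulKerLE (f ^ b • ea) ea j G)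
    (h₃ : SMulKerLE (f ^ (a - 1) • ea) (f ^ b • ea) (f ^ (b + 1) • ea) G) [Module.Finite R G]
    (n : ℕ) (X : Type u) [AddCommGroup X] [Module R X] [Module R[X] X] [Module G X]
    [IsScalarTower R R[X] X] [IsScalarTower R[X] G X] [IsScalarTower R G X] [Module.Finite G X]
    (hX : HasProjectiveDimensionLT (ModuleCat.of G X) (n + 1)) :
    (((a - b) * f.natDegree : ℕ) : ℤ) ∣ smulRank R ea X - smulRank R eb X := by
  have : IsNoetherianRing G := isNoetherian_of_tower R inferInstance
  induction n generalizing X with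
  | zero =>
    have := projective_iff_hasProjectiveDimensionLT_one'.2 hX
    have : Module.Finite R X := Module.Finite.trans G X
    exact dvd_smulRank_sub_of_projective hf hab hj hj' hfj hfa h₁ h₂ h₃ X
  | succ n ih =>
    obtain ⟨k, p, hp⟩ := Module.Finite.exists_fin' G X
    have : IsScalarTower R[X] G (LinearMap.ker p) := ⟨fun r g x => Subtype.ext (smul_assoc r g x.1)⟩
    have : IsScalarTower R R[X] (LinearMap.ker p) := ⟨fun r g x => Subtype.ext (smul_assoc r g x.1)⟩
    have hker := ih (LinearMap.ker p) ((hasProjectiveDimensionLT_ker_iff p hp n).1 hX)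
    have hfree : (((a - b) * f.natDegree : ℕ) : ℤ) ∣
        smulRank R ea (Fin k → G) - smulRank R eb (Fin k → G) :=
      dvd_smulRank_sub_of_projective hf hab hj hj' hfj hfa h₁ h₂ h₃ _
    rw [smulRank_eq_add_ker R hea p hp, smulRank_eq_add_ker R heb p hp] at hfree
    push_cast at hfree hker ⊢
    rw [add_sub_add_comm] at hfree
    exact (dvd_add_left hker).1 hfree

theorem globalDimension_eq_top_of_not_dvd (hf : Irreducible f) {a b : ℕ} (hab : b < a)
    {ea eb j : G} (hea : ea * ea = ea) (heb : eb * eb = eb)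
    (hj : ea * j = j) (hj' : j * eb = j) (hfj : f ^ b • j = 0) (hfa : f ^ a • ea = 0)
    (h₁ : SMulKerLE j eb 0 G) (h₂ : SMulKerLE (f ^ b • ea) ea j G)
    (h₃ : SMulKerLE (f ^ (a - 1) • ea) (f ^ b • ea) (f ^ (b + 1) • ea) G) [Module.Finite R G]
    (J : Submodule G G)
    (hJ : ¬ (((a - b) * f.natDegree : ℕ) : ℤ) ∣ smulRank R ea J - smulRank R eb J) :
    globalDimension G = ⊤ := by
  have : IsNoetherianRing G := isNoetherian_of_tower R inferInstance
  have : IsScalarTower R[X] G J := ⟨fun r g x => Subtype.ext (smul_assoc r g x.1)⟩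
  have : IsScalarTower R R[X] J := ⟨fun r g x => Subtype.ext (smul_assoc r g x.1)⟩
  have htop : projectiveDimension (ModuleCat.of G J) = ⊤ := by
    by_contra h
    obtain ⟨n, hn⟩ := (projectiveDimension_ne_top_iff _).1 h
    exact hJ (dvd_smulRank_sub_of_hasProjectiveDimensionLT hf hab hea heb hj hj' hfj hfa h₁ h₂ h₃
      n J hn)
  rw [eq_top_iff, ← htop]
  exact le_iSup (fun X : {X : ModuleCat.{u} G // Module.Finite G X} =>
    projectiveDimension X.1) ⟨ModuleCat.of G J, inferInstanceAs (Module.Finite G J)⟩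

end Gap

/-! ### Linear maps between the modules `R[x]/(f^t)`. -/

section TruncPoly

variable {R : Type u} [Field R] {f : R[X]}

theorem TruncPoly.mk_eq_smul_one {t : ℕ} (p : R[X]) :
    (Ideal.Quotient.mk _ p : TruncPoly f t) = p • (1 : TruncPoly f t) := by
  change _ = Ideal.Quotient.mk _ (p • 1)
  rw [smul_eq_mul, mul_one]

theorem TruncPoly.smul_one_eq_zero_iff {t : ℕ} (p : R[X]) :
    p • (1 : TruncPoly f t) = 0 ↔ f ^ t ∣ p := by
  rw [← mk_eq_smul_one, Ideal.Quotient.eq_zero_iff_mem, Ideal.mem_span_singleton]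

theorem TruncPoly.exists_eq_smul_one {t : ℕ} (q : TruncPoly f t) : ∃ p : R[X], q = p • 1 := by
  obtain ⟨p, rfl⟩ := Ideal.Quotient.mk_surjective q
  exact ⟨p, mk_eq_smul_one p⟩

theorem TruncPoly.pow_smul_eq_zero {t k : ℕ} (h : t ≤ k) (q : TruncPoly f t) : f ^ k • q = 0 := by
  obtain ⟨p, rfl⟩ := exists_eq_smul_one q
  rw [smul_smul, smul_one_eq_zero_iff]
  exact dvd_mul_of_dvd_left (pow_dvd_pow f h) p

/-- The linear map out of `R[x]/(f^t)` sending `1` to an element annihilated by `f^t`. -/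
noncomputable def TruncPoly.lift {t : ℕ} {V : Type*} [AddCommGroup V] [Module R[X] V] (v : V)
    (hv : f ^ t • v = 0) : TruncPoly f t →ₗ[R[X]] V :=
  Submodule.liftQ _ (LinearMap.toSpanSingleton R[X] V v) (by
    rw [Ideal.span, Submodule.span_singleton_le_iff_mem]
    exact hv)

theorem TruncPoly.lift_smul_one {t : ℕ} {V : Type*} [AddCommGroup V] [Module R[X] V] (v : V)
    (hv : f ^ t • v = 0) (p : R[X]) : lift v hv (p • (1 : TruncPoly f t)) = p • v := by
  rw [← mk_eq_smul_one]
  rfl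

theorem TruncPoly.lift_one {t : ℕ} {V : Type*} [AddCommGroup V] [Module R[X] V] (v : V)
    (hv : f ^ t • v = 0) : lift v hv (1 : TruncPoly f t) = v := by
  simpa using lift_smul_one v hv 1

theorem TruncPoly.hom_ext {t : ℕ} {V : Type*} [AddCommGroup V] [Module R[X] V]
    {g h : TruncPoly f t →ₗ[R[X]] V} (H : g 1 = h 1) : g = h := by
  refine LinearMap.ext fun q => ?_
  obtain ⟨p, rfl⟩ := exists_eq_smul_one q
  rw [map_smul, map_smul, H]

theorem TruncPoly.finrank_eq (t : ℕ) : Module.finrank R (TruncPoly f t) = t * f.natDegree := by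
  rw [finrank_quotient_span_eq_natDegree, Polynomial.natDegree_pow]

/-- The map `R[x]/(f^b) → R[x]/(f^a)` given by multiplication by `f^(a-b)`. -/
noncomputable def TruncPoly.inclusion {a b : ℕ} (h : b ≤ a) :
    TruncPoly f b →ₗ[R[X]] TruncPoly f a :=
  lift (f ^ (a - b) • 1) (by
    rw [smul_smul, ← pow_add, smul_one_eq_zero_iff, Nat.add_sub_cancel' h])

theorem TruncPoly.inclusion_injective (hf : f ≠ 0) {a b : ℕ} (h : b ≤ a) :
    Function.Injective (inclusion h : TruncPoly f b →ₗ[R[X]] TruncPoly f a) := by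
  rw [injective_iff_map_eq_zero]
  intro q hq
  obtain ⟨p, rfl⟩ := exists_eq_smul_one q
  rw [inclusion, lift_smul_one, smul_smul, smul_one_eq_zero_iff,
    show f ^ a = f ^ b * f ^ (a - b) by rw [← pow_add, Nat.add_sub_cancel' h]] at hq
  exact (smul_one_eq_zero_iff p).2 ((mul_dvd_mul_iff_right (pow_ne_zero _ hf)).1 hq)

theorem TruncPoly.mem_range_inclusion (hf : f ≠ 0) {a b : ℕ} (h : b ≤ a) (q : TruncPoly f a)
    (hq : f ^ b • q = 0) : q ∈ LinearMap.range (inclusion h : TruncPoly f b →ₗ[R[X]] _) := by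
  obtain ⟨p, rfl⟩ := exists_eq_smul_one q
  rw [smul_smul, smul_one_eq_zero_iff,
    show f ^ a = f ^ b * f ^ (a - b) by rw [← pow_add, Nat.add_sub_cancel' h]] at hq
  obtain ⟨c, rfl⟩ := (mul_dvd_mul_iff_left (pow_ne_zero _ hf)).1 hq
  exact ⟨c • 1, by rw [inclusion, lift_smul_one, smul_smul, mul_comm]⟩

end TruncPoly

/-! ### Infinite global dimension from a gap in `T`. -/

section GapModule

variable {R : Type u} [Field R] {f : R[X]} {M : Type u} [AddCommGroup M] [Module R M]
  [Module R[X] M] [IsScalarTower R R[X] M] [Module.Finite R M]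

instance : Module.Finite R (Module.End R[X] M) :=
  Module.Finite.of_injective (LinearMap.restrictScalarsₗ R R[X] M M R)
    (LinearMap.restrictScalars_injective R)

/-- Here `ea = ja ∘ ra`, `eb = jb ∘ rb`, and `j` is the embedding of `M(b)` into `M(a)` extended to
`M`. Hypothesis `H` encodes the gap in the form needed for `h₃`. -/
theorem globalDimension_moduleEnd_eq_top_of_retracts (hf : Irreducible f) {a b : ℕ}
    (hab : b + 1 < a) (ja : TruncPoly f a →ₗ[R[X]] M) (ra : M →ₗ[R[X]] TruncPoly f a)
    (ha : ra ∘ₗ ja = LinearMap.id) (jb : TruncPoly f b →ₗ[R[X]] M)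
    (rb : M →ₗ[R[X]] TruncPoly f b) (hb : rb ∘ₗ jb = LinearMap.id)
    (H : ∀ h : M →ₗ[R[X]] TruncPoly f a, f ^ (a - 1) • h = 0 →
      ∃ h' : M →ₗ[R[X]] TruncPoly f a, f ^ b • h = f ^ (b + 1) • h') :
    globalDimension (Module.End R[X] M) = ⊤ := by
  have ha' (x) : ra (ja x) = x := LinearMap.congr_fun ha x
  have hb' (x) : rb (jb x) = x := LinearMap.congr_fun hb x
  have hfb : f ^ b • (jb ∘ₗ rb : Module.End R[X] M) = 0 := by
    ext x
    change f ^ b • jb (rb x) = 0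
    rw [← map_smul, TruncPoly.pow_smul_eq_zero le_rfl, map_zero]
  -- The exponent `b + 1` makes `eb J` vanish while `ea J ≅ R[x]/(f^(a-b-1))`; as `b + 1 < a`, this
  -- is nonzero and of dimension less than `(a - b) * deg f`.
  let J : Submodule (Module.End R[X] M) (Module.End R[X] M) :=
    Submodule.span _ {f ^ (b + 1) • (ja ∘ₗ ra : Module.End R[X] M)}
  have hJb : smulRank R (jb ∘ₗ rb : Module.End R[X] M) J = 0 := by
    have : LinearMap.range (Algebra.lsmul R R J (jb ∘ₗ rb : Module.End R[X] M)) = ⊥ := by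
      rw [LinearMap.range_eq_bot]
      ext ⟨x, hx⟩ : 2
      obtain ⟨g, rfl⟩ := Submodule.mem_span_singleton.1 hx
      ext y
      change jb (rb (g (f ^ (b + 1) • ja (ra y)))) = 0
      rw [map_smul, map_smul, TruncPoly.pow_smul_eq_zero (Nat.le_succ b), map_zero]
    rw [smulRank, this, finrank_bot]
  have hJa : smulRank R (ja ∘ₗ ra : Module.End R[X] M) J = (a - b - 1) * f.natDegree := by
    let Ψ : R[X] →ₗ[R[X]] Module.End R[X] M :=
      LinearMap.toSpanSingleton R[X] _ (f ^ (b + 1) • (ja ∘ₗ ra : Module.End R[X] M))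
    have hker : LinearMap.ker Ψ = Ideal.span {f ^ (a - b - 1)} := by
      ext p
      have hpow : f ^ a = f ^ (a - b - 1) * f ^ (b + 1) := by
        rw [← pow_add]; congr 1; omega
      rw [Ideal.mem_span_singleton, LinearMap.mem_ker,
        ← mul_dvd_mul_iff_right (pow_ne_zero (b + 1) hf.ne_zero), ← hpow,
        ← TruncPoly.smul_one_eq_zero_iff]
      have hΨ (x) : Ψ p x = ja ((p * f ^ (b + 1)) • ra x) := by
        change p • f ^ (b + 1) • ja (ra x) = _
        rw [smul_smul, map_smul]
      constructor
      · intro h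
        have := hΨ (ja 1)
        rw [h, ha'] at this
        rw [← ha' (_ • 1), ← this, LinearMap.zero_apply, map_zero]
      · intro h
        ext x
        obtain ⟨q, hq⟩ := TruncPoly.exists_eq_smul_one (ra x)
        rw [hΨ, hq, smul_comm, h, smul_zero, map_zero, LinearMap.zero_apply]
    let incl : J →ₗ[R] Module.End R[X] M := J.subtype.restrictScalars R
    have himage : (LinearMap.range (Algebra.lsmul R R J (ja ∘ₗ ra : Module.End R[X] M))).map incl =
        (LinearMap.range Ψ).restrictScalars R := by
      ext x
      constructor
      · rintro ⟨_, ⟨⟨y, hy⟩, rfl⟩, rfl⟩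
        obtain ⟨g, rfl⟩ := Submodule.mem_span_singleton.1 hy
        -- Every endomorphism of the cyclic module `M(a)` is multiplication by a polynomial, so `ea
        -- g ea = p • ea`.
        obtain ⟨p, hp⟩ := TruncPoly.exists_eq_smul_one (ra (g (ja 1)))
        refine ⟨p, ?_⟩
        ext y
        obtain ⟨q, hq⟩ := TruncPoly.exists_eq_smul_one (ra y)
        change p • f ^ (b + 1) • ja (ra y) = ja (ra (g (f ^ (b + 1) • ja (ra y))))
        simp only [hq, map_smul, hp]
        simp only [← map_smul]
        congr 1
        simp only [smul_smul]
        congr 1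
        ring
      · rintro ⟨p, rfl⟩
        refine ⟨_, ⟨⟨(p • (1 : Module.End R[X] M)) • (f ^ (b + 1) • (ja ∘ₗ ra)),
          Submodule.mem_span_singleton.2 ⟨_, rfl⟩⟩, rfl⟩, ?_⟩
        ext y
        change ja (ra (p • f ^ (b + 1) • ja (ra y))) = p • f ^ (b + 1) • ja (ra y)
        simp only [map_smul, ha']
    rw [smulRank, (Submodule.equivMapOfInjective incl Subtype.val_injective _).finrank_eq, himage,
      ← TruncPoly.finrank_eq]
    exact ((((Submodule.quotEquivOfEq _ _ hker).symm.trans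
      Ψ.quotKerEquivRange).restrictScalars R).finrank_eq).symm
  refine globalDimension_eq_top_of_not_dvd (R := R) hf (a := a) (b := b) (by omega)
    (ea := ja ∘ₗ ra) (eb := jb ∘ₗ rb) (j := ja ∘ₗ TruncPoly.inclusion (by omega) ∘ₗ rb)
    ?_ ?_ ?_ ?_ ?_ ?_ ?_ ?_ ?_ J ?_
  · ext x; simp [ha']
  · ext x; simp [hb']
  · ext x; simp [ha']
  · ext x; simp [hb']
  · ext x
    change f ^ b • ja (TruncPoly.inclusion (show b ≤ a by omega) (rb x)) = 0
    rw [← map_smul, ← map_smul, TruncPoly.pow_smul_eq_zero le_rfl, map_zero, map_zero]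
  · ext x
    change f ^ a • ja (ra x) = 0
    rw [← map_smul, TruncPoly.pow_smul_eq_zero le_rfl, map_zero]
  · intro g hg
    refine ⟨0, ?_⟩
    ext x
    have h0 : ja (TruncPoly.inclusion (show b ≤ a by omega) (rb (g x))) = 0 :=
      LinearMap.congr_fun hg x
    replace h0 := congrArg ra h0
    rw [ha', map_zero, map_eq_zero_iff _ (TruncPoly.inclusion_injective hf.ne_zero _)] at h0
    change jb (rb (g x)) = (0 : Module.End R[X] M) ((0 : Module.End R[X] M) x)
    rw [h0, map_zero, LinearMap.zero_apply]
  · intro g hg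
    have hrange (x) : ra (g x) ∈
        LinearMap.range (TruncPoly.inclusion (show b ≤ a by omega) : TruncPoly f b →ₗ[R[X]] _) := by
      refine TruncPoly.mem_range_inclusion hf.ne_zero _ _ ?_
      have h0 : f ^ b • ja (ra (g x)) = 0 := LinearMap.congr_fun hg x
      replace h0 := congrArg ra h0
      rwa [map_smul, ha', map_zero] at h0
    let δ : M →ₗ[R[X]] TruncPoly f b :=
      (LinearEquiv.ofInjective _ (TruncPoly.inclusion_injective hf.ne_zero
        (show b ≤ a by omega))).symm.toLinearMap ∘ₗ (ra ∘ₗ g).codRestrict _ hrange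
    refine ⟨jb ∘ₗ δ, ?_⟩
    ext x
    change ja (ra (g x)) = ja (TruncPoly.inclusion (show b ≤ a by omega) (rb (jb (δ x))))
    rw [hb']
    congr 1
    exact (congrArg Subtype.val (LinearEquiv.apply_symm_apply (LinearEquiv.ofInjective _
      (TruncPoly.inclusion_injective hf.ne_zero (show b ≤ a by omega))) ⟨_, hrange x⟩)).symm
  · intro g hg
    obtain ⟨h', hh'⟩ := H (ra ∘ₗ g) (by
      ext x
      have h0 : f ^ (a - 1) • ja (ra (g x)) = 0 := LinearMap.congr_fun hg x
      replace h0 := congrArg ra h0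
      rwa [map_smul, ha', map_zero] at h0)
    refine ⟨ja ∘ₗ h', ?_⟩
    ext x
    change f ^ b • ja (ra (g x)) = f ^ (b + 1) • ja (ra (ja (h' x)))
    rw [ha']
    exact (ja.map_smul _ _).symm.trans
      ((congrArg ja (LinearMap.congr_fun hh' x)).trans (ja.map_smul _ _))
  · rw [hJa, hJb]
    intro hdvd
    have hdeg : 0 < f.natDegree := hf.natDegree_pos
    rw [Nat.cast_zero, sub_zero, Int.natCast_dvd_natCast] at hdvd
    have := Nat.le_of_dvd (by omega) (Nat.dvd_of_mul_dvd_mul_right hdeg hdvd)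
    omega

/-- This is where the gap enters. For `t ≤ b`, `f ^ b` kills the source. For `a ≤ t`, the value at
`1` may be any element of the target, so a factor `f` of `h 1` can be divided out of the map itself.
-/
theorem TruncPoly.exists_pow_smul_eq (hf : f ≠ 0) {a b t : ℕ} (hab : b < a) (ht : t ≤ b ∨ a ≤ t)
    (h : TruncPoly f t →ₗ[R[X]] TruncPoly f a) (h0 : f ^ (a - 1) • h = 0) :
    ∃ h' : TruncPoly f t →ₗ[R[X]] TruncPoly f a, f ^ b • h = f ^ (b + 1) • h' := by
  obtain ht | ht := ht
  · refine ⟨0, LinearMap.ext fun q => ?_⟩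
    rw [smul_zero, LinearMap.smul_apply, ← map_smul, pow_smul_eq_zero ht, map_zero]
    rfl
  · obtain ⟨p, hp⟩ := exists_eq_smul_one (h 1)
    have hdvd := LinearMap.congr_fun h0 1
    rw [LinearMap.smul_apply, hp, smul_smul, LinearMap.zero_apply, smul_one_eq_zero_iff,
      show f ^ a = f ^ (a - 1) * f by rw [← pow_succ]; congr 1; omega,
      mul_dvd_mul_iff_left (pow_ne_zero _ hf)] at hdvd
    obtain ⟨c, rfl⟩ := hdvd
    refine ⟨lift (c • 1) (pow_smul_eq_zero ht _), hom_ext ?_⟩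
    rw [LinearMap.smul_apply, LinearMap.smul_apply, hp, lift_one, smul_smul, smul_smul]
    congr 1
    ring

section CyclicMod

variable {t m : ℕ} (h : t ≤ m)

noncomputable instance CyclicMod.instModulePolynomial : Module R[X] (CyclicMod f h) :=
  inferInstanceAs (Module R[X] (TruncPoly f t))

instance CyclicMod.instIsScalarTowerBasePolynomial : IsScalarTower R R[X] (CyclicMod f h) :=
  inferInstanceAs (IsScalarTower R R[X] (TruncPoly f t))

instance CyclicMod.instIsScalarTowerPolynomial :
    IsScalarTower R[X] (TruncPoly f m) (CyclicMod f h) where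
  smul_assoc r a x := by
    induction a using Submodule.Quotient.induction_on with | _ a
    induction x using Submodule.Quotient.induction_on with | _ x
    exact congrArg (Ideal.Quotient.mk (Ideal.span {f ^ t})) (smul_mul_assoc r a x)

/-- The identity map from `R[x]/(f^t)`, viewed as a module over `R[x]/(f^m)`, to `R[x]/(f^t)`. -/
noncomputable def CyclicMod.equivTruncPoly : CyclicMod f h ≃ₗ[R[X]] TruncPoly f t :=
  LinearEquiv.refl R[X] (TruncPoly f t)

theorem CyclicMod.finite (hf : f ≠ 0) : Module.Finite R (CyclicMod f h) :=
  (AdjoinRoot.powerBasis (pow_ne_zero t hf)).finite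

end CyclicMod

theorem globalDimension_moduleEnd_cyclicSum_eq_top (hf : Irreducible f) {T : Finset ℕ} {m a b : ℕ}
    (h : ∀ t ∈ T, t ≤ m) (hab : b + 1 < a) (ha : a ∈ T) (hb : b ∈ T ∨ b = 0)
    (hT : ∀ t ∈ T, t ≤ b ∨ a ≤ t) :
    globalDimension (Module.End R[X] (CyclicSum f T h)) = ⊤ := by
  classical
  have hfin (t : T) := CyclicMod.finite (f := f) (h t t.2) hf.ne_zero
  have : Module.Finite R (CyclicSum f T h) :=
    Module.Finite.equiv
      (DirectSum.linearEquivFunOnFintype R T fun t => CyclicMod f (h t t.2)).symm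
  let incl (t : T) : TruncPoly f t →ₗ[R[X]] CyclicSum f T h :=
    DirectSum.lof R[X] T (fun t => CyclicMod f (h t t.2)) t ∘ₗ
      (CyclicMod.equivTruncPoly (h t t.2)).symm.toLinearMap
  let proj (t : T) : CyclicSum f T h →ₗ[R[X]] TruncPoly f t :=
    (CyclicMod.equivTruncPoly (h t t.2)).toLinearMap ∘ₗ
      DirectSum.component R[X] T (fun t => CyclicMod f (h t t.2)) t
  have hretract (t : T) : proj t ∘ₗ incl t = LinearMap.id :=
    LinearMap.ext fun q => congrArg (CyclicMod.equivTruncPoly (h t t.2))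
      (DirectSum.component.lof_self (ι := T) (M := fun t => CyclicMod f (h t t.2)) R[X] t _)
  obtain ⟨jb, rb, hjb⟩ : ∃ (jb : TruncPoly f b →ₗ[R[X]] CyclicSum f T h)
      (rb : CyclicSum f T h →ₗ[R[X]] TruncPoly f b), rb ∘ₗ jb = LinearMap.id := by
    obtain hb | rfl := hb
    · exact ⟨_, _, hretract ⟨b, hb⟩⟩
    -- For `b = 0` the module `M(0)` is zero, a retract of anything through zero maps.
    · refine ⟨0, 0, TruncPoly.hom_ext ?_⟩
      simp
  refine globalDimension_moduleEnd_eq_top_of_retracts hf hab _ _ (hretract ⟨a, ha⟩) jb rb hjb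
    fun g h0 => ?_
  choose g' hg' using fun t : T => TruncPoly.exists_pow_smul_eq hf.ne_zero (by omega) (hT t t.2)
    (g ∘ₗ incl t) (LinearMap.ext fun q => LinearMap.congr_fun h0 (incl t q))
  refine ⟨DirectSum.toModule R[X] T _ fun t => g' t ∘ₗ
    (CyclicMod.equivTruncPoly (h t t.2)).toLinearMap, ?_⟩
  refine DirectSum.linearMap_ext _ fun t => LinearMap.ext fun q => ?_
  simpa [incl] using LinearMap.congr_fun (hg' t) (CyclicMod.equivTruncPoly (h t t.2) q)

end GapModule

/-! ### Finitely generated and indecomposable modules over `R[x]/(f^m)`. -/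

section Classification

variable {R : Type u} [Field R] {f : R[X]} {m : ℕ}

theorem exists_equiv_pi_cyclicMod (hf : Irreducible f) (X : Type u) [AddCommGroup X]
    [Module (TruncPoly f m) X] [Module.Finite (TruncPoly f m) X] :
    ∃ (d : ℕ) (k : Fin d → ℕ) (hk : ∀ i, k i ≤ m),
      Nonempty (X ≃ₗ[TruncPoly f m] (∀ i, CyclicMod f (hk i))) := by
  let _ : Module R[X] X := Module.compHom X (algebraMap R[X] (TruncPoly f m))
  have : @IsScalarTower R[X] (TruncPoly f m) X Algebra.toSMul _ _ :=
    IsScalarTower.of_algebraMap_smul fun _ _ => rfl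
  have : Module.Finite R[X] X := Module.Finite.trans (TruncPoly f m) X
  have hsmul (x : X) : f ^ m • x = 0 := by
    rw [← one_smul (TruncPoly f m) x, ← smul_assoc]
    exact (congrArg (· • x) (TruncPoly.pow_smul_eq_zero (f := f) (le_refl m) 1)).trans
      (zero_smul (TruncPoly f m) x)
  obtain ⟨d, k, ⟨e⟩⟩ := Module.torsion_by_prime_power_decomposition (p := f) (M := X) hf
    ((Submodule.isTorsion'_powers_iff f).2 fun x => ⟨m, hsmul x⟩)
  have hk (i) : k i ≤ m := by
    have h0 : f ^ m • DirectSum.lof R[X] (Fin d) (fun i => R[X] ⧸ Submodule.span R[X] {f ^ k i})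
        i (Ideal.Quotient.mk _ 1) = 0 := by
      apply e.symm.injective
      rw [map_smul, hsmul, map_zero]
    rw [← map_smul] at h0
    replace h0 := congrArg (DirectSum.component R[X] (Fin d) _ i) h0
    rw [DirectSum.component.lof_self, map_zero] at h0
    have h1 : f ^ k i ∣ f ^ m :=
      (TruncPoly.smul_one_eq_zero_iff (f := f) (t := k i) (f ^ m)).1 h0
    exact (pow_dvd_pow_iff hf.ne_zero hf.not_isUnit).1 h1
  refine ⟨d, k, hk, ⟨LinearEquiv.extendScalarsOfSurjective
    (R := R[X]) Ideal.Quotient.mk_surjective (e.trans ((DirectSum.linearEquivFunOnFintype R[X] _ _).trans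
      (LinearEquiv.piCongrRight fun i => (CyclicMod.equivTruncPoly (hk i)).symm)))⟩⟩

/-- `X` is a direct summand of `N`. -/
def IsRetract (S : Type u) [Ring S] (X N : Type u) [AddCommGroup X] [Module S X]
    [AddCommGroup N] [Module S N] : Prop :=
  ∃ (i : X →ₗ[S] N) (p : N →ₗ[S] X), p ∘ₗ i = LinearMap.id

theorem CyclicMod.subsingleton_of_eq_zero {t : ℕ} (h : t ≤ m) (ht : t = 0) :
    Subsingleton (CyclicMod f h) := by
  subst ht
  exact Ideal.Quotient.subsingleton_iff.2 (by simp)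

theorem isAdditiveGenerator_of_isRetract (hf : Irreducible f) (N : Type u) [AddCommGroup N]
    [Module (TruncPoly f m) N] [Module.Finite (TruncPoly f m) N]
    (hN : ∀ t (h : t ≤ m), 1 ≤ t → IsRetract (TruncPoly f m) (CyclicMod f h) N) :
    IsAdditiveGenerator (TruncPoly f m) N := by
  refine ⟨inferInstance, fun X _ _ _ => ?_⟩
  obtain ⟨d, k, hk, ⟨e⟩⟩ := exists_equiv_pi_cyclicMod (m := m) hf X
  have hret (j) : IsRetract (TruncPoly f m) (CyclicMod f (hk j)) N := by
    obtain h0 | h0 := Nat.eq_zero_or_pos (k j)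
    · have := CyclicMod.subsingleton_of_eq_zero (f := f) (hk j) h0
      exact ⟨0, 0, Subsingleton.elim _ _⟩
    · exact hN _ _ h0
  choose i p hip using hret
  refine ⟨d, LinearMap.pi fun j => i j ∘ₗ LinearMap.proj j ∘ₗ e.toLinearMap,
    e.symm.toLinearMap ∘ₗ LinearMap.pi fun j => p j ∘ₗ LinearMap.proj j, ?_⟩
  ext x
  apply e.injective
  ext j
  simpa using LinearMap.congr_fun (hip j) (e x j)

/-- An idempotent is multiplication by some `p` with `f ^ t ∣ p * (p - 1)`. The irreducible `f` is
coprime to `p` or to `p - 1`, so `f ^ t` divides the other factor. -/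
theorem TruncPoly.eq_zero_or_eq_id_of_idempotent (hf : Irreducible f) {t : ℕ}
    (e : TruncPoly f t →ₗ[R[X]] TruncPoly f t) (he : e ∘ₗ e = e) : e = 0 ∨ e = LinearMap.id := by
  obtain ⟨p, hp⟩ := exists_eq_smul_one (e 1)
  have h1 := LinearMap.congr_fun he 1
  rw [LinearMap.comp_apply, hp, map_smul, hp, smul_smul, ← sub_eq_zero, ← sub_smul,
    smul_one_eq_zero_iff, ← mul_sub_one] at h1
  by_cases hfp : f ∣ p
  · left
    have hcop : IsCoprime f (p - 1) := by
      rw [hf.coprime_iff_not_dvd]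
      intro h
      exact hf.not_isUnit (isUnit_of_dvd_one (by simpa using dvd_sub hfp h))
    refine hom_ext ?_
    rw [hp, LinearMap.zero_apply, smul_one_eq_zero_iff]
    exact hcop.pow_left.dvd_of_dvd_mul_right h1
  · right
    have hcop : IsCoprime f p := (hf.coprime_iff_not_dvd).2 hfp
    refine hom_ext ?_
    rw [hp, LinearMap.id_apply, ← sub_eq_zero]
    have := (smul_one_eq_zero_iff (f := f) (t := t) (p - 1)).2 (hcop.pow_left.dvd_of_dvd_mul_left h1)
    rwa [sub_smul, one_smul] at this

theorem CyclicMod.eq_zero_or_eq_id_of_idempotent (hf : Irreducible f) {t : ℕ} (h : t ≤ m)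
    (e : CyclicMod f h →ₗ[TruncPoly f m] CyclicMod f h) (he : e ∘ₗ e = e) :
    e = 0 ∨ e = LinearMap.id := by
  let φ := CyclicMod.equivTruncPoly (f := f) h
  have := TruncPoly.eq_zero_or_eq_id_of_idempotent hf
    (φ.toLinearMap ∘ₗ e.restrictScalars R[X] ∘ₗ φ.symm.toLinearMap)
    (LinearMap.ext fun x => LinearMap.congr_fun he x)
  refine this.imp (fun h0 => LinearMap.ext fun x => ?_) (fun h0 => LinearMap.ext fun x => ?_) <;>
  · have := LinearMap.congr_fun h0 (φ x)
    exact this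

theorem CyclicMod.nontrivial (hf : Irreducible f) {t : ℕ} (h : t ≤ m) (ht : 1 ≤ t) :
    Nontrivial (CyclicMod f h) :=
  Ideal.Quotient.nontrivial_iff.2 (by
    rw [Ne, Ideal.span_singleton_eq_top, isUnit_pow_iff (by omega)]
    exact hf.not_isUnit)

theorem CyclicMod.indecomposable (hf : Irreducible f) {t : ℕ} (h : t ≤ m) (ht : 1 ≤ t) :
    Indecomposable (ModuleCat.of (TruncPoly f m) (CyclicMod f h)) := by
  have := CyclicMod.nontrivial hf h ht
  refine ⟨?_, fun Y Z e => ?_⟩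
  · rw [ModuleCat.isZero_iff_subsingleton, not_subsingleton_iff_nontrivial]
    exact this
  -- The idempotent projecting onto `Y`: if it is `0` then `Y` is zero, if it is the identity then
  -- `Z` is zero.
  · let ε := e.hom ≫ Limits.biprod.fst ≫ Limits.biprod.inl ≫ e.inv
    have hε : ε ≫ ε = ε := by simp [ε]
    obtain h0 | h0 := CyclicMod.eq_zero_or_eq_id_of_idempotent hf h ε.hom
      (congrArg ModuleCat.Hom.hom hε)
    · left
      have h0' : ε = 0 := ModuleCat.hom_ext h0
      rw [Limits.IsZero.iff_id_eq_zero]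
      have : 𝟙 Y = Limits.biprod.inl ≫ e.inv ≫ ε ≫ e.hom ≫ Limits.biprod.fst := by simp [ε]
      rw [this, h0']
      simp
    · right
      have h0' : ε = 𝟙 _ := ModuleCat.hom_ext h0
      rw [Limits.IsZero.iff_id_eq_zero]
      have h1 : Limits.biprod.inr ≫ e.inv ≫ ε ≫ e.hom ≫ Limits.biprod.snd = (0 : Z ⟶ Z) := by
        simp [ε]
      rw [← h1, h0']
      simp

theorem linearEquiv_of_isRetract_of_indecomposable {S : Type u} [Ring S] {C X : Type u}
    [AddCommGroup C] [Module S C] [AddCommGroup X] [Module S X] [Nontrivial C]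
    (hX : Indecomposable (ModuleCat.of S X)) (h : IsRetract S C X) : Nonempty (X ≃ₗ[S] C) := by
  obtain ⟨i, p, hip⟩ := h
  have hip' (c) : p (i c) = c := LinearMap.congr_fun hip c
  -- The retraction splits `X` as `C × ker p`; indecomposability and `C ≠ 0` force `ker p = 0`.
  let e : X ≃ₗ[S] C × LinearMap.ker p :=
    { toFun := fun x => (p x, ⟨x - i (p x), by simp [hip']⟩)
      map_add' := fun x y => by ext <;> simp <;> abel
      map_smul' := fun s x => by ext <;> simp [smul_sub]
      invFun := fun y => i y.1 + y.2
      left_inv := fun x => by simp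
      right_inv := fun y => by
        have := LinearMap.mem_ker.1 y.2.2
        ext <;> simp [hip', this] }
  obtain h0 | h0 := hX.2 (ModuleCat.of S C) (ModuleCat.of S (LinearMap.ker p))
    (e.toModuleIso ≪≫ (ModuleCat.biprodIsoProd (ModuleCat.of S C) (ModuleCat.of S (LinearMap.ker p))).symm)
  · rw [ModuleCat.isZero_iff_subsingleton] at h0
    exact absurd h0 (not_subsingleton_iff_nontrivial.2 ‹_›)
  · rw [ModuleCat.isZero_iff_subsingleton] at h0
    have h0 : Subsingleton (LinearMap.ker p) := h0
    refine ⟨LinearEquiv.ofBijective p ⟨?_, fun c => ⟨i c, hip' c⟩⟩⟩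
    rw [← LinearMap.ker_eq_bot]
    exact Submodule.subsingleton_iff_eq_bot.1 h0

theorem exists_equiv_cyclicMod_of_indecomposable (hf : Irreducible f) (X : Type u)
    [AddCommGroup X] [Module (TruncPoly f m) X] [Module.Finite (TruncPoly f m) X]
    (hX : Indecomposable (ModuleCat.of (TruncPoly f m) X)) :
    ∃ (t : ℕ) (h : t ≤ m), 1 ≤ t ∧ Nonempty (X ≃ₗ[TruncPoly f m] CyclicMod f h) := by
  obtain ⟨d, k, hk, ⟨e⟩⟩ := exists_equiv_pi_cyclicMod (m := m) hf X
  obtain ⟨j, hj⟩ : ∃ j : Fin d, 1 ≤ k j := by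
    by_contra! hall
    have (j : Fin d) := CyclicMod.subsingleton_of_eq_zero (f := f) (hk j) (by have := hall j; omega)
    apply hX.1
    rw [ModuleCat.isZero_iff_subsingleton]
    exact e.toEquiv.subsingleton
  have := CyclicMod.nontrivial hf (hk j) hj
  refine ⟨k j, hk j, hj, linearEquiv_of_isRetract_of_indecomposable hX
    ⟨e.symm.toLinearMap ∘ₗ 
      LinearMap.single (TruncPoly f m) (fun i => CyclicMod f (hk i)) j,
      LinearMap.proj j ∘ₗ e.toLinearMap, ?_⟩⟩
  ext x
  simp

theorem CyclicMod.le_of_linearEquiv {s t : ℕ} (hf : Irreducible f) (hs : s ≤ m) (ht : t ≤ m)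
    (e : CyclicMod f hs ≃ₗ[TruncPoly f m] CyclicMod f ht) : s ≤ t := by
  let φ := CyclicMod.equivTruncPoly (f := f) hs
  let ψ := CyclicMod.equivTruncPoly (f := f) ht
  let E : TruncPoly f s ≃ₗ[R[X]] TruncPoly f t :=
    (φ.symm.trans (e.restrictScalars R[X])).trans ψ
  have : f ^ t • (1 : TruncPoly f s) = 0 := by
    apply E.injective
    rw [map_smul, TruncPoly.pow_smul_eq_zero le_rfl, map_zero]
  rw [TruncPoly.smul_one_eq_zero_iff] at this
  exact (pow_dvd_pow_iff hf.ne_zero hf.not_isUnit).1 this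

end Classification

/-- If `P → S` is surjective, then the `S`-linear endomorphisms are the `P`-linear ones. -/
def Module.End.restrictScalarsAlgEquiv (R P S V : Type*) [CommRing R] [CommRing P] [CommRing S]
    [Algebra R P] [Algebra P S] [Algebra R S] [AddCommGroup V] [Module R V] [Module P V]
    [Module S V] [IsScalarTower R P V] [IsScalarTower R S V] [IsScalarTower P S V]
    (h : Function.Surjective (algebraMap P S)) :
    Module.End S V ≃ₐ[R] Module.End P V where
  toFun g := g.restrictScalars P
  invFun g := LinearMap.extendScalarsOfSurjective h g
  left_inv _ := rfl
  right_inv _ := rfl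
  map_mul' _ _ := rfl
  map_add' _ _ := rfl
  commutes' _ := rfl

/-! ### Change of base ring, Auslander algebras and the final assembly. -/

section Final

variable {R : Type u} [Field R] {f : R[X]}

instance CyclicSum.instIsScalarTowerPolynomial {T : Finset ℕ} {m : ℕ} (h : ∀ t ∈ T, t ≤ m) :
    @IsScalarTower R[X] (TruncPoly f m) (CyclicSum f T h) Algebra.toSMul _ _ :=
  ⟨fun r s x => by
    ext t
    exact smul_assoc r s (x t)⟩

/-- The endomorphism algebra of `⨁ M(t)` over `R[x]/(f^m)` is the one over `R[x]`. -/
noncomputable def CyclicSum.endEquivPolynomial {T : Finset ℕ} {m : ℕ} (h : ∀ t ∈ T, t ≤ m) :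
    Module.End (TruncPoly f m) (CyclicSum f T h) ≃ₐ[R] Module.End R[X] (CyclicSum f T h) :=
  Module.End.restrictScalarsAlgEquiv R R[X] (TruncPoly f m) (CyclicSum f T h)
    Ideal.Quotient.mk_surjective

/-- The `R[x]`-module `⨁ M(t)` does not depend on the bound `m`. -/
noncomputable def CyclicSum.equivOfBounds {T : Finset ℕ} {m m' : ℕ} (h : ∀ t ∈ T, t ≤ m)
    (h' : ∀ t ∈ T, t ≤ m') : CyclicSum f T h ≃ₗ[R[X]] CyclicSum f T h' :=
  DFinsupp.mapRange.linearEquiv fun t : T =>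
    (CyclicMod.equivTruncPoly (h t t.2)).trans (CyclicMod.equivTruncPoly (h' t t.2)).symm

/-- The endomorphism algebra of `⨁ M(t)` does not depend on the bound `m`. -/
noncomputable def CyclicSum.endEquivOfBounds {T : Finset ℕ} {m m' : ℕ} (h : ∀ t ∈ T, t ≤ m)
    (h' : ∀ t ∈ T, t ≤ m') : Module.End (TruncPoly f m) (CyclicSum f T h) ≃ₐ[R]
      Module.End (TruncPoly f m') (CyclicSum f T h') :=
  (CyclicSum.endEquivPolynomial h).trans
    (((CyclicSum.equivOfBounds h h').conjAlgEquiv R).trans (CyclicSum.endEquivPolynomial h').symm)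

instance CyclicMod.instFinite {t m : ℕ} (h : t ≤ m) :
    Module.Finite (TruncPoly f m) (CyclicMod f h) :=
  Module.Finite.of_surjective
    ({ toFun := Ideal.Quotient.factor (Ideal.span_singleton_le_span_singleton.2 (pow_dvd_pow f h))
       map_add' := map_add _
       map_smul' := fun a b => map_mul (Ideal.Quotient.factor
         (Ideal.span_singleton_le_span_singleton.2 (pow_dvd_pow f h))) a b } : TruncPoly f m →ₗ[TruncPoly f m] CyclicMod f h)
    (Ideal.Quotient.factor_surjective
      (Ideal.span_singleton_le_span_singleton.2 (pow_dvd_pow f h)))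

theorem DirectSum.finite_of_fintype {S ι : Type*} [Ring S] [Fintype ι] (N : ι → Type*)
    [∀ i, AddCommGroup (N i)] [∀ i, Module S (N i)] [∀ i, Module.Finite S (N i)] :
    Module.Finite S (⨁ i, N i) :=
  Module.Finite.equiv (DirectSum.linearEquivFunOnFintype S ι N).symm

theorem isRetract_directSum {S : Type u} [Ring S] {ι : Type} [DecidableEq ι] (N : ι → Type u)
    [∀ i, AddCommGroup (N i)] [∀ i, Module S (N i)] (i : ι) {C : Type u} [AddCommGroup C]
    [Module S C] (e : C ≃ₗ[S] N i) : IsRetract S C (⨁ i, N i) := by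
  refine ⟨DirectSum.lof S ι N i ∘ₗ e.toLinearMap,
    e.symm.toLinearMap ∘ₗ DirectSum.component S ι N i, ?_⟩
  ext x
  simp [DirectSum.component.lof_self]

/-- `R[x]/(f^s)` and `R[x]/(f^t)` are the same module if `s = t`. -/
noncomputable def CyclicMod.equivOfEq {s t m : ℕ} (hs : s ≤ m) (ht : t ≤ m) (h : s = t) :
    CyclicMod f hs ≃ₗ[TruncPoly f m] CyclicMod f ht := by
  subst h
  exact LinearEquiv.refl _ _

theorem isAdditiveGenerator_cyclicSum (hf : Irreducible f) {T : Finset ℕ} {m : ℕ}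
    (h : ∀ t ∈ T, t ≤ m) (hT : ∀ t, 1 ≤ t → t ≤ m → t ∈ T) :
    IsAdditiveGenerator (TruncPoly f m) (CyclicSum f T h) := by
  classical
  have : Module.Finite (TruncPoly f m) (CyclicSum f T h) :=
    DirectSum.finite_of_fintype _
  exact isAdditiveGenerator_of_isRetract hf _ fun t ht h1 =>
    isRetract_directSum (fun t : T => CyclicMod f (h t t.2)) ⟨t, hT t h1 ht⟩ (LinearEquiv.refl _ _)

open scoped ModuleCat in
-- A complete list of indecomposables contains a copy of each `M(t)` with `1 ≤ t ≤ m`, so its sum is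
-- an additive generator and Auslander's bound applies.
theorem globalDimension_le_two_of_isAuslanderAlgebra (hf : Irreducible f) {m : ℕ} {G : Type u}
    [Ring G] [Algebra R G] (h : IsAuslanderAlgebra R (TruncPoly f m) G) :
    globalDimension G ≤ 2 := by
  obtain ⟨k, N, hN, -, hcomplete, ⟨e⟩⟩ := h
  rw [globalDimension_eq_of_ringEquiv e.toRingEquiv]
  have (i : Fin k) := (hN i).1
  have : Module.Finite (TruncPoly f m) (⨁ i, N i) := DirectSum.finite_of_fintype _
  refine globalDimension_moduleEnd_le_two (isAdditiveGenerator_of_isRetract hf _ fun t ht h1 => ?_)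
  obtain ⟨i, ⟨φ⟩⟩ := hcomplete (ModuleCat.of _ (CyclicMod f ht)) (CyclicMod.instFinite ht)
    (CyclicMod.indecomposable hf ht h1)
  exact isRetract_directSum (fun i => N i) i φ.toLinearEquiv

open scoped ModuleCat in
theorem nonempty_algEquiv_end_of_linearEquiv {S : Type u} [Ring S] [Algebra R S] {V : Type u}
    [AddCommGroup V] [Module R V] [Module S V] [IsScalarTower R S V] {k : ℕ}
    (N : Fin k → ModuleCat.{u} S) (e : V ≃ₗ[S] ⨁ i, N i) :
    Nonempty (Module.End S V ≃ₐ[R] Module.End S (⨁ i, N i)) :=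
  ⟨e.conjAlgEquiv R⟩

theorem isAuslanderAlgebra_end_cyclicSum (hf : Irreducible f) {T : Finset ℕ} {m : ℕ}
    (h : ∀ t ∈ T, t ≤ m) (hT : T = Finset.Icc 1 m) :
    IsAuslanderAlgebra R (TruncPoly f m) (Module.End (TruncPoly f m) (CyclicSum f T h)) := by
  classical
  have hlt (i : Fin m) : i.1 + 1 ≤ m := i.2
  -- The index `i : Fin m` stands for the exponent `i + 1`, since `M(0) = 0` is not indecomposable.
  let σ : T ≃ Fin m :=
    { toFun := fun t => ⟨t - 1, by have := t.2; simp only [hT, Finset.mem_Icc] at this; omega⟩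
      invFun := fun i => ⟨i + 1, by simp [hT]⟩
      left_inv := fun t => by
        have := t.2
        simp only [hT, Finset.mem_Icc] at this
        ext
        simp
        omega
      right_inv := fun i => by simp }
  let N (i : Fin m) : ModuleCat.{u} (TruncPoly f m) := ModuleCat.of _ (CyclicMod f (hlt i))
  refine ⟨m, N, fun i =>
    ⟨CyclicMod.instFinite _, CyclicMod.indecomposable hf _ (Nat.le_add_left 1 i)⟩, ?_, ?_, ?_⟩
  · rintro i j ⟨e⟩
    have h1 := CyclicMod.le_of_linearEquiv hf _ _ e.toLinearEquiv
    have h2 := CyclicMod.le_of_linearEquiv hf _ _ e.symm.toLinearEquiv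
    ext
    omega
  · intro X hX hind
    obtain ⟨t, ht, h1, ⟨e⟩⟩ := exists_equiv_cyclicMod_of_indecomposable hf X hind
    obtain ⟨s, rfl⟩ := Nat.exists_eq_add_of_le' h1
    exact ⟨⟨s, ht⟩, ⟨e.toModuleIso⟩⟩
  · have e : CyclicSum f T h ≃ₗ[TruncPoly f m] ⨁ i, N i :=
      LinearEquiv.symm <| (DirectSum.lequivCongrLeft (TruncPoly f m) σ.symm).trans
        (DFinsupp.mapRange.linearEquiv fun t : T =>
          CyclicMod.equivOfEq (f := f) (hlt (σ t)) (h t t.2) (by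
            have := t.2
            simp only [hT, Finset.mem_Icc] at this
            simp [σ]
            omega))
    exact nonempty_algEquiv_end_of_linearEquiv N e

theorem globalDimension_moduleEnd_cyclicSum_eq_zero (hf : Irreducible f) {T : Finset ℕ} {m : ℕ}
    (h : ∀ t ∈ T, t ≤ m) (hT : T = {1}) :
    globalDimension (Module.End R[X] (CyclicSum f T h)) = 0 := by
  classical
  have hsimple (t : T) : IsSimpleModule R[X] (CyclicMod f (h t t.2)) := by
    obtain ⟨t, ht⟩ := t
    obtain rfl : t = 1 := by simpa [hT] using ht
    have hmax : (Ideal.span {f ^ 1}).IsMaximal := by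
      rw [pow_one]
      exact PrincipalIdealRing.isMaximal_of_irreducible hf
    have := isSimpleModule_iff_isCoatom.2 (Ideal.isMaximal_def.1 hmax)
    exact IsSimpleModule.congr (CyclicMod.equivTruncPoly _)
  have : IsSemisimpleModule R[X] (CyclicSum f T h) :=
    inferInstanceAs (IsSemisimpleModule R[X] (Π₀ t : T, CyclicMod f (h t t.2)))
  have : Module.Finite R[X] (CyclicSum f T h) := DirectSum.finite_of_fintype _
  have : Nontrivial (CyclicSum f T h) := by
    have h1 : 1 ∈ T := by simp [hT]
    have := CyclicMod.nontrivial hf (h 1 h1) le_rfl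
    exact (DirectSum.of_injective (β := fun t : T => CyclicMod f (h t t.2)) ⟨1, h1⟩).nontrivial
  have := IsSemisimpleRing.moduleEnd R[X] (CyclicSum f T h)
  exact globalDimension_eq_zero_of_isSemisimpleRing _

theorem two_le_globalDimension_moduleEnd_cyclicSum (hf : Irreducible f) {T : Finset ℕ} {m t : ℕ}
    (h : ∀ t ∈ T, t ≤ m) (ht : t ∈ T) (h2 : 2 ≤ t) :
    2 ≤ globalDimension (Module.End R[X] (CyclicSum f T h)) := by
  classical
  refine two_le_globalDimension_of_isNilpotent (f • 1)
    (fun s => (Commute.one_right s).smul_right f) ⟨m, ?_⟩ fun h0 => ?_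
  · rw [smul_pow, one_pow]
    exact LinearMap.ext fun x => DFinsupp.ext fun s =>
      TruncPoly.pow_smul_eq_zero (h s s.2) (CyclicMod.equivTruncPoly (h s s.2) (x s))
  · let x : CyclicSum f T h := DirectSum.lof R[X] T (fun t => CyclicMod f (h t t.2)) ⟨t, ht⟩
      ((CyclicMod.equivTruncPoly _).symm 1)
    have h1 : f • x = 0 := LinearMap.congr_fun h0 x
    replace h1 := congrArg (DirectSum.component R[X] T (fun t => CyclicMod f (h t t.2)) ⟨t, ht⟩) h1
    rw [map_smul, DirectSum.component.lof_self, map_zero] at h1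
    have h3 : f ^ t ∣ f ^ 1 := (pow_one f).symm ▸ (TruncPoly.smul_one_eq_zero_iff (t := t) f).1 h1
    have := (pow_dvd_pow_iff hf.ne_zero hf.not_isUnit).1 h3
    omega

theorem Finset.exists_gap_of_notMem {T : Finset ℕ} {c m : ℕ} (hc : 1 ≤ c) (hcT : c ∉ T)
    (hm : m ∈ T) (hcm : c ≤ m) :
    ∃ a b, b + 1 < a ∧ a ∈ T ∧ (b ∈ T ∨ b = 0) ∧ ∀ t ∈ T, t ≤ b ∨ a ≤ t := by
  have ha : ∃ a, c ≤ a ∧ a ∈ T := ⟨m, hcm, hm⟩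
  classical
  obtain ⟨h1, h2⟩ := Nat.find_spec ha
  obtain ⟨b, hb, hle⟩ : ∃ b ∈ insert 0 (T.filter (· < c)), ∀ t ∈ insert 0 (T.filter (· < c)), t ≤ b :=
    ⟨_, Finset.max'_mem _ (Finset.insert_nonempty _ _), fun t ht => Finset.le_max' _ t ht⟩
  simp only [Finset.mem_insert, Finset.mem_filter] at hb hle
  -- Here `a` is the least element of `T` above the missing `c`, and `b` the greatest element of `T`
  -- below `c`, or `0` if there is none; `b < c < a` gives `b + 1 < a`.
  have hca : c ≠ Nat.find ha := fun h => hcT (h ▸ h2)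
  refine ⟨Nat.find ha, b, by omega, h2, by tauto, fun t ht => ?_⟩
  by_cases htc : t < c
  · exact Or.inl (hle t (Or.inr ⟨ht, htc⟩))
  · exact Or.inr (Nat.find_min' ha ⟨by omega, ht⟩)

open scoped ModuleCat in
theorem IsAuslanderAlgebra.of_algEquiv {S : Type u} [Ring S] [Algebra R S] {G G' : Type u} [Ring G]
    [Algebra R G] [Ring G'] [Algebra R G'] (h : IsAuslanderAlgebra R S G) (e : G' ≃ₐ[R] G) :
    IsAuslanderAlgebra R S G' := by
  obtain ⟨k, N, h1, h2, h3, ⟨φ⟩⟩ := h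
  exact ⟨k, N, h1, h2, h3, ⟨e.trans φ⟩⟩

end Final

theorem corollary3p7 {R : Type u} [Field R] (f : R[X]) (hf : Irreducible f) (n : ℕ)
    (T : Finset ℕ) (hne : T.Nonempty) (hT : T ⊆ Finset.Icc 1 n) :
    let A := TruncPoly f n
    let M := CyclicSum f T (m := n) (fun _ ht => (Finset.mem_Icc.1 (hT ht)).2)
    let Γ := Module.End A M
    let t₁ := T.max' hne
    let B := TruncPoly f t₁
    let MB := CyclicSum f T (m := t₁) T.le_max'
    (t₁ = 1 → globalDimension Γ = 0) ∧
    (t₁ ≠ 1 → IsAdditiveGenerator B MB → globalDimension Γ = 2) ∧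
    (t₁ ≠ 1 → ¬ IsAdditiveGenerator B MB → globalDimension Γ = ⊤) ∧
    (globalDimension Γ < ⊤ ↔ IsAuslanderAlgebra R B Γ) := by
  intro A M Γ t₁ B MB
  let E : Γ ≃ₐ[R] Module.End B MB := CyclicSum.endEquivOfBounds _ _
  let EP := (CyclicSum.endEquivPolynomial (f := f) (m := t₁) T.le_max').toRingEquiv
  -- The actions of `A` and `B` both come from `R[x]` through surjections, so all three endomorphism
  -- rings agree.
  have hEP : globalDimension Γ = globalDimension (Module.End R[X] MB) :=
    globalDimension_eq_of_ringEquiv (E.toRingEquiv.trans EP)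
  have hmem : t₁ ∈ T := T.max'_mem hne
  have hpos (t) (ht : t ∈ T) : 1 ≤ t := (Finset.mem_Icc.1 (hT ht)).1
  have hsub : T ⊆ Finset.Icc 1 t₁ := fun t ht => Finset.mem_Icc.2 ⟨hpos t ht, T.le_max' t ht⟩
  have hzero (h1 : t₁ = 1) : globalDimension Γ = 0 := by
    rw [hEP]
    refine globalDimension_moduleEnd_cyclicSum_eq_zero hf _ (Finset.eq_singleton_iff_unique_mem.2
      ⟨h1 ▸ hmem, fun t ht => ?_⟩)
    have := Finset.mem_Icc.1 (hsub ht)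
    omega
  have htwo (hgen : IsAdditiveGenerator B MB) : globalDimension Γ ≤ 2 := by
    rw [globalDimension_eq_of_ringEquiv E.toRingEquiv]
    exact globalDimension_moduleEnd_le_two hgen
  have htop (hfull : T ≠ Finset.Icc 1 t₁) : globalDimension Γ = ⊤ := by
    obtain ⟨c, hc, hcT⟩ := Finset.not_subset.1 fun h => hfull (hsub.antisymm h)
    rw [Finset.mem_Icc] at hc
    obtain ⟨a, b, hab, ha, hb, hgap⟩ := Finset.exists_gap_of_notMem hc.1 hcT hmem hc.2
    rw [hEP]
    exact globalDimension_moduleEnd_cyclicSum_eq_top hf _ hab ha hb hgap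
  have hgen (hfull : T = Finset.Icc 1 t₁) : IsAdditiveGenerator B MB :=
    isAdditiveGenerator_cyclicSum hf _ fun t h1 ht => hfull ▸ Finset.mem_Icc.2 ⟨h1, ht⟩
  have hlt : (2 : WithBot ℕ∞) < ⊤ := by decide
  refine ⟨hzero, fun h1 hg => le_antisymm (htwo hg) ?_, fun _ hg => htop fun h => hg (hgen h),
    fun h => ?_, fun h => (globalDimension_le_two_of_isAuslanderAlgebra hf h).trans_lt hlt⟩
  · rw [hEP]
    have := hpos _ hmem
    exact two_le_globalDimension_moduleEnd_cyclicSum hf _ hmem (by omega)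
  · have hfull : T = Finset.Icc 1 t₁ := by
      by_contra hfull
      exact h.ne (htop hfull)
    exact (isAuslanderAlgebra_end_cyclicSum hf _ hfull).of_algEquiv E
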